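/- Let $R_1,R_2>0$ and equip $S^2\times S^2$ (unit spheres with Cartesian coordinates $(x_i,y_i,z_i)$, $i=1,2$) with the symplectic form $\omega=R_1\,\omega_{S^2}\oplus R_2\,\omega_{S^2}$, where $\omega_{S^2}$ is the standard area form. For $w\in\mathbb R$ and $\mathbf t=(t_0,t_1,t_2,t_3,t_4)\in\mathbb R^5$ let $$J=R_1z_1+R_2z_2,\qquad H_{w,\mathbf t}=t_0(z_1+z_2)^2+w(t_1z_1+t_2z_2)+t_3(x_1x_2+y_1y_2)+t_4z_1z_2 .$$ The trigonometric Gaudin model is the case $w=0$. Put $m_0=(0,0,1,0,0,-1)$ and, for $w=0$, $t_{4,m_0}^{+}=\dfrac{2t_3\sqrt{R_1R_2}}{R_1+R_2}$. The bifurcation parameter is $t_4$; all other parameters are fixed. In canonical coordinates $(q_1,q_2,p_1,p_2)$ write $S=q_1p_2-q_2p_1$, $M=\frac12(q_1^2+q_2^2)$, $N=\frac12(p_1^2+p_2^2)$. A family $H_t$ goes through a subcritical Hamiltonian Hopf bifurcation at a rank $0$ singularity $m$ of the momentum maps $(J,H_t)$ and at $t=t_*$ if there are $\rho\neq0$, $\sigma\in\{1,-1\}$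 and $a\in\mathbb R$ with $\sigma a<0$ such that: * for $t$ in an open interval around $t_*$, the quadratic part of $H_t$ at $m$ takes the form $(\rho+\nu_1(t))S+\sigma N-\nu_2(t)M$ in linear symplectic coordinates depending smoothly on $t$, where $\nu_1,\nu_2$ are smooth, $\nu_1(t_*)=\nu_2(t_*)=0$ and $\nu_2'(t_*)\neq0$; * in suitable canonical coordinates near $m$, $H_{t_*}-H_{t_*}(m)=\rho S+\sigma N+aM^2+bMS+cS^2+O(|(q,p)|^5)$ for some $b,c\in\mathbb R$. **Corollary 5.2.** In the trigonometric Gaudin model, $m_0$ goes through a subcritical Hamiltonian Hopf bifurcation at $t_4=t_{4,m_0}^{+}$ if $R_1\neq R_2$ and either 1. $2(R_1+R_2)t_0>-\sqrt{R_1R_2}\,t_3$ and $t_3<0$, or 2. $2(R_1+R_2)t_0<-\sqrt{R_1R_2}\,t_3$ and $t_3>0$. -/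

import Mathlib

open scoped ContDiff Topology Matrix

/-- Cartesian coordinates `(x, y, z)` on `ℝ³`. -/
abbrev Space3 : Type := EuclideanSpace ℝ (Fin 3)

/-- The ambient space `ℝ³ × ℝ³`, with coordinates `(x₁, y₁, z₁, x₂, y₂, z₂)`. -/
abbrev SpinSpace : Type := Space3 × Space3

/-- The phase space `S² × S²`. -/
def phaseSpace : Set SpinSpace :=
  Metric.sphere (0 : Space3) 1 ×ˢ Metric.sphere (0 : Space3) 1

/-- The standard area form of the unit sphere `S² ⊆ ℝ³` at the point `u`, evaluated on the tangent
vectors `v` and `w`: the triple product `⟨u, v × w⟩`. -/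
def sphereAreaForm (u v w : Space3) : ℝ :=
  u.ofLp ⬝ᵥ (v.ofLp ⨯₃ w.ofLp)

/-- The symplectic form `R₁ ω_{S²} ⊕ R₂ ω_{S²}` on `S² × S²` at the point `z`. -/
def spinForm (R₁ R₂ : ℝ) (z v w : SpinSpace) : ℝ :=
  R₁ * sphereAreaForm z.1 v.1 w.1 + R₂ * sphereAreaForm z.2 v.2 w.2

/-- The symplectic vector space `ℝ⁴` with coordinates `(q, p) = ((q₁, q₂), (p₁, p₂))`. -/
abbrev CanonicalSpace : Type := (Fin 2 → ℝ) × (Fin 2 → ℝ)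

/-- The standard symplectic form `dq₁ ∧ dp₁ + dq₂ ∧ dp₂`. -/
def standardForm (v w : CanonicalSpace) : ℝ :=
  (v.1 0 * w.2 0 - v.2 0 * w.1 0) + (v.1 1 * w.2 1 - v.2 1 * w.1 1)

/-- `Ψ : U → S² × S²` gives canonical coordinates `(q, p)` near the point `z`: it is smooth on the
open neighbourhood `U` of `0`, sends `0` to `z`, and pulls the symplectic form back to the standard
one. (As the standard form is nondegenerate, `Ψ` is then a local diffeomorphism onto a neighbourhood
of `z` in the four-dimensional manifold `S² × S²`.) -/
structure IsCanonicalParam (R₁ R₂ : ℝ) (z : SpinSpace) (U : Set CanonicalSpace)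
    (Ψ : CanonicalSpace → SpinSpace) : Prop where
  isOpen : IsOpen U
  zero_mem : (0 : CanonicalSpace) ∈ U
  smooth : ContDiffOn ℝ ∞ Ψ U
  mapsTo : Set.MapsTo Ψ U phaseSpace
  map_zero : Ψ 0 = z
  symplectic : ∀ x ∈ U, ∀ v w : CanonicalSpace,
    spinForm R₁ R₂ (Ψ x) (fderiv ℝ Ψ x v) (fderiv ℝ Ψ x w) = standardForm v w

/-- The Hilbert generator `S = q₁ p₂ - q₂ p₁`. -/
def hilbertS (x : CanonicalSpace) : ℝ := x.1 0 * x.2 1 - x.1 1 * x.2 0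

/-- The Hilbert generator `M = (q₁² + q₂²) / 2`. -/
noncomputable def hilbertM (x : CanonicalSpace) : ℝ := (x.1 0 ^ 2 + x.1 1 ^ 2) / 2

/-- The Hilbert generator `N = (p₁² + p₂²) / 2`. -/
noncomputable def hilbertN (x : CanonicalSpace) : ℝ := (x.2 0 ^ 2 + x.2 1 ^ 2) / 2

/-- `z` is a rank `0` singularity of the momentum map `F`: in canonical coordinates near `z` the
Jacobian of `F` at `z` is zero. -/
def IsRankZeroSingularity (R₁ R₂ : ℝ) (F : SpinSpace → ℝ × ℝ) (z : SpinSpace) : Prop :=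
  z ∈ phaseSpace ∧ ∀ U Ψ, IsCanonicalParam R₁ R₂ z U Ψ →
    HasFDerivAt (fun x => F (Ψ x)) (0 : CanonicalSpace →L[ℝ] ℝ × ℝ) 0

/-- The quadratic parts `H_t²` of the Taylor expansions of `H_t` at the point `z` have, for `t` in
an open interval around `t₀`, the unfolding
`(ρ + ν₁(t)) S + σ N - ν₂(t) M`, with `ν₁, ν₂` smooth, `ν₁(t₀) = ν₂(t₀) = 0` and `ν₂'(t₀) ≠ 0`,
with respect to linear symplectic coordinates (given by `P t`) that depend smoothly on `t`. For
`ρ ≠ 0` and `σ = ±1` this says that `H_t` goes through a linear Hamiltonian Hopf bifurcation.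
(The other usual form `(ρ + ν₁) S + σ M - ν₂ N` is obtained from this one by the symplectic change
of coordinates `(q, p) ↦ (p, -q)`, which fixes `S` and exchanges `M` and `N`.) -/
def HasLinearHopfUnfolding (R₁ R₂ : ℝ) (H : ℝ → SpinSpace → ℝ) (z : SpinSpace) (t₀ ρ σ : ℝ) :
    Prop :=
  ∃ U Ψ, IsCanonicalParam R₁ R₂ z U Ψ ∧
    ∃ a b : ℝ, t₀ ∈ Set.Ioo a b ∧
    ∃ (ν₁ ν₂ : ℝ → ℝ) (P : ℝ → CanonicalSpace →L[ℝ] CanonicalSpace),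
      ContDiffOn ℝ ∞ ν₁ (Set.Ioo a b) ∧ ContDiffOn ℝ ∞ ν₂ (Set.Ioo a b) ∧
      ContDiffOn ℝ ∞ P (Set.Ioo a b) ∧
      ν₁ t₀ = 0 ∧ ν₂ t₀ = 0 ∧ deriv ν₂ t₀ ≠ 0 ∧
      ∀ t ∈ Set.Ioo a b,
        (∀ v w : CanonicalSpace, standardForm (P t v) (P t w) = standardForm v w) ∧
        Asymptotics.IsBigO (𝓝 0)
          (fun x : CanonicalSpace => H t (Ψ (P t x)) - H t z -
            ((ρ + ν₁ t) * hilbertS x + σ * hilbertN x - ν₂ t * hilbertM x))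
          (fun x : CanonicalSpace => ‖x‖ ^ 3)

/-- In suitable canonical coordinates near `z`, the function `H` is, up to its constant term, in the
normal form `ρ S + σ N + a M² + b M S + c S² + higher order terms`, where the higher order terms
have order at least five in `(q, p)`. -/
def HasHopfNormalForm (R₁ R₂ : ℝ) (H : SpinSpace → ℝ) (z : SpinSpace) (ρ σ a : ℝ) : Prop :=
  ∃ U Ψ, IsCanonicalParam R₁ R₂ z U Ψ ∧
    ∃ b c : ℝ,
      Asymptotics.IsBigO (𝓝 0)
        (fun x : CanonicalSpace => H (Ψ x) - H z -
          (ρ * hilbertS x + σ * hilbertN x +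
            a * hilbertM x ^ 2 + b * (hilbertM x * hilbertS x) + c * hilbertS x ^ 2))
        (fun x : CanonicalSpace => ‖x‖ ^ 5)

/-- The rank `0` singularity `z` of the system with momentum maps `F_t = (J, H_t)` on
`(S² × S², R₁ ω_{S²} ⊕ R₂ ω_{S²})` goes through a subcritical Hamiltonian Hopf bifurcation at
`t = t₀`: the quadratic part goes through a linear Hamiltonian Hopf bifurcation, and in the normal
form of `H_{t₀}` the coefficient `a` of `M²` satisfies `σ a < 0`. -/
def UndergoesSubcriticalHopf (R₁ R₂ : ℝ) (F : ℝ → SpinSpace → ℝ × ℝ) (z : SpinSpace) (t₀ : ℝ) :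
    Prop :=
  (∀ t, IsRankZeroSingularity R₁ R₂ (F t) z) ∧
  ∃ ρ σ a : ℝ, ρ ≠ 0 ∧ (σ = 1 ∨ σ = -1) ∧
    HasLinearHopfUnfolding R₁ R₂ (fun t x => (F t x).2) z t₀ ρ σ ∧
    HasHopfNormalForm R₁ R₂ (fun x => (F t₀ x).2) z ρ σ a ∧
    σ * a < 0

/-- The first integral `J = R₁ z₁ + R₂ z₂`. -/
def gaudinJ (R₁ R₂ : ℝ) (m : SpinSpace) : ℝ := R₁ * m.1 2 + R₂ * m.2 2

/-- The Hamiltonian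
`H = t₀ (z₁ + z₂)² + w (t₁ z₁ + t₂ z₂) + t₃ (x₁ x₂ + y₁ y₂) + t₄ z₁ z₂`. -/
def gaudinH (w t₀ t₁ t₂ t₃ t₄ : ℝ) (m : SpinSpace) : ℝ :=
  t₀ * (m.1 2 + m.2 2) ^ 2 + w * (t₁ * m.1 2 + t₂ * m.2 2) +
    t₃ * (m.1 0 * m.2 0 + m.1 1 * m.2 1) + t₄ * (m.1 2 * m.2 2)

/-- The momentum map `(J, H)` of the generalised coupled angular momenta system; the trigonometric
Gaudin model is the case `w = 0`. -/
def gaudinMomentumMap (R₁ R₂ w t₀ t₁ t₂ t₃ t₄ : ℝ) (m : SpinSpace) : ℝ × ℝ :=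
  (gaudinJ R₁ R₂ m, gaudinH w t₀ t₁ t₂ t₃ t₄ m)

/-- The point `m₀ = (0, 0, 1, 0, 0, -1)`. -/
noncomputable def pointM0 : SpinSpace := (!₂[0, 0, 1], !₂[0, 0, -1])

/-- The bifurcation value
`t₄⁺ = (w (t₁ R₂ - t₂ R₁) + 2 t₃ √(R₁ R₂)) / (R₁ + R₂)` at `m₀`. -/
noncomputable def t4PlusM0 (R₁ R₂ w t₁ t₂ t₃ : ℝ) : ℝ :=
  (w * (t₁ * R₂ - t₂ * R₁) + 2 * t₃ * √(R₁ * R₂)) / (R₁ + R₂)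

/-! Equal-area charts at the two poles, followed by a linear map mixing the two spheres, give
canonical coordinates near `pointM0` in which the Hamiltonian is an exact function of S, M, N
(`gaudinH_polarChart`). Put κ = -2a₁a₂t₃ and e = a₁² + a₂², where 2Rᵢaᵢ² = 1. The quadratic part is
t₄(a₂² - a₁²)S + (κ + t₄e)N - (κ - t₄e)M. Hence the M term vanishes exactly at t₄e = κ, and scaling
q and p inversely makes the coefficient of N equal to σ, the sign of κ.

At that value the quartic part is a polynomial in S, M, N. Adding σN to ρS makes MN, N² and SN
removable by symplectic changes of coordinates that leave the M² coefficient alone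
(`HasExpansion.hasHopfNormalForm`). The changes used are cubic transvections, and fourth powers of
linear forms serve as their generating functions. The M² coefficient is a positive multiple of (a₂²
- a₁²)²(t₀ + t₄/4), so the two sign conditions on the parameters say that σ(t₀ + t₄/4) < 0. The
condition R₁ ≠ R₂ makes a₂² - a₁² nonzero, which both ρ ≠ 0 and a ≠ 0 need. -/

/-! ### Equal-area charts of the sphere -/

/-- Lambert's equal-area chart of the unit sphere around the pole `(0, 0, ε)`, for `ε = ±1`. -/
noncomputable def equalAreaChart (ε : ℝ) (u : ℝ × ℝ) : Space3 :=
  !₂[u.1 * √(1 - (u.1 ^ 2 + u.2 ^ 2) / 4), u.2 * √(1 - (u.1 ^ 2 + u.2 ^ 2) / 4),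
    ε * (1 - (u.1 ^ 2 + u.2 ^ 2) / 2)]

theorem equalAreaChart_mem_sphere {ε : ℝ} (hε : ε ^ 2 = 1) {u : ℝ × ℝ}
    (hu : u.1 ^ 2 + u.2 ^ 2 < 4) : equalAreaChart ε u ∈ Metric.sphere (0 : Space3) 1 := by
  have hs : √(1 - (u.1 ^ 2 + u.2 ^ 2) / 4) ^ 2 = 1 - (u.1 ^ 2 + u.2 ^ 2) / 4 :=
    Real.sq_sqrt (by linarith)
  rw [mem_sphere_zero_iff_norm, EuclideanSpace.norm_eq, Real.sqrt_eq_one]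
  simp only [equalAreaChart, Real.norm_eq_abs, sq_abs, Fin.sum_univ_three, PiLp.toLp_apply,
    Matrix.cons_val_zero, Matrix.cons_val_one, Matrix.cons_val]
  linear_combination (u.1 ^ 2 + u.2 ^ 2) * hs + (1 - (u.1 ^ 2 + u.2 ^ 2) / 2) ^ 2 * hε

theorem contDiffAt_equalAreaChart (ε : ℝ) {u : ℝ × ℝ} (hu : u.1 ^ 2 + u.2 ^ 2 < 4) :
    ContDiffAt ℝ ∞ (equalAreaChart ε) u := by
  have hs : ContDiffAt ℝ ∞ (fun u : ℝ × ℝ => √(1 - (u.1 ^ 2 + u.2 ^ 2) / 4)) u := by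
    refine ContDiffAt.sqrt (by fun_prop) (by linarith)
  rw [contDiffAt_euclidean]
  intro i
  fin_cases i
  · exact contDiffAt_fst.mul hs
  · exact contDiffAt_snd.mul hs
  · change ContDiffAt ℝ ∞ (fun u : ℝ × ℝ => ε * (1 - (u.1 ^ 2 + u.2 ^ 2) / 2)) u
    fun_prop

/-- The components of the derivative of the equal-area chart. -/
theorem fderiv_equalAreaChart (ε : ℝ) {u : ℝ × ℝ} (hu : u.1 ^ 2 + u.2 ^ 2 < 4) (v : ℝ × ℝ) :
    ∃ d : ℝ, √(1 - (u.1 ^ 2 + u.2 ^ 2) / 4) * d = -(u.1 * v.1 + u.2 * v.2) / 4 ∧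
      fderiv ℝ (equalAreaChart ε) u v 0 = v.1 * √(1 - (u.1 ^ 2 + u.2 ^ 2) / 4) + u.1 * d ∧
      fderiv ℝ (equalAreaChart ε) u v 1 = v.2 * √(1 - (u.1 ^ 2 + u.2 ^ 2) / 4) + u.2 * d ∧
      fderiv ℝ (equalAreaChart ε) u v 2 = -ε * (u.1 * v.1 + u.2 * v.2) := by
  have hpos : 0 < 1 - (u.1 ^ 2 + u.2 ^ 2) / 4 := by linarith
  have hs0 : √(1 - (u.1 ^ 2 + u.2 ^ 2) / 4) ≠ 0 := (Real.sqrt_pos.2 hpos).ne'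
  have hD : HasFDerivAt (equalAreaChart ε) (fderiv ℝ (equalAreaChart ε) u) u :=
    ((contDiffAt_equalAreaChart ε hu).differentiableAt (by simp)).hasFDerivAt
  have hline := hD.hasLineDerivAt v
  have hcomp (i : Fin 3) : HasDerivAt (fun τ : ℝ => equalAreaChart ε (u + τ • v) i)
      (fderiv ℝ (equalAreaChart ε) u v i) 0 :=
    (EuclideanSpace.proj (𝕜 := ℝ) i).hasFDerivAt.comp_hasDerivAt (0 : ℝ) hline
  have hx : HasDerivAt (fun τ : ℝ => u.1 + τ * v.1) v.1 0 := by
    simpa using ((hasDerivAt_id (0 : ℝ)).mul_const v.1).const_add u.1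
  have hy : HasDerivAt (fun τ : ℝ => u.2 + τ * v.2) v.2 0 := by
    simpa using ((hasDerivAt_id (0 : ℝ)).mul_const v.2).const_add u.2
  have hr : HasDerivAt (fun τ : ℝ => (u.1 + τ * v.1) ^ 2 + (u.2 + τ * v.2) ^ 2)
      (2 * (u.1 * v.1 + u.2 * v.2)) 0 := by
    refine ((hx.pow 2).add (hy.pow 2)).congr_deriv ?_
    simp
    ring
  have hs : HasDerivAt (fun τ : ℝ => √(1 - ((u.1 + τ * v.1) ^ 2 + (u.2 + τ * v.2) ^ 2) / 4))
      (-(2 * (u.1 * v.1 + u.2 * v.2) / 4) / (2 * √(1 - (u.1 ^ 2 + u.2 ^ 2) / 4))) 0 := by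
    convert ((hr.div_const 4).const_sub 1).sqrt (by simpa using hpos.ne') using 1
    simp
  -- The witness is the derivative of the square root along `v`.
  refine ⟨-(2 * (u.1 * v.1 + u.2 * v.2) / 4) / (2 * √(1 - (u.1 ^ 2 + u.2 ^ 2) / 4)), ?_,
    (hcomp 0).unique ?_, (hcomp 1).unique ?_, (hcomp 2).unique ?_⟩
  · generalize √(1 - (u.1 ^ 2 + u.2 ^ 2) / 4) = s at *
    field_simp
  · exact (hx.mul hs).congr_deriv (by simp)
  · exact (hy.mul hs).congr_deriv (by simp)
  · exact (((hr.div_const 2).const_sub 1).const_mul ε).congr_deriv (by ring)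

/-- The height is affine in the squared radius, as in Archimedes' theorem, so area is preserved. The
factor `ε` records that the chart reverses orientation at the south pole. -/
theorem sphereAreaForm_equalAreaChart (ε : ℝ) {u : ℝ × ℝ}
    (hu : u.1 ^ 2 + u.2 ^ 2 < 4) (v w : ℝ × ℝ) :
    sphereAreaForm (equalAreaChart ε u) (fderiv ℝ (equalAreaChart ε) u v)
      (fderiv ℝ (equalAreaChart ε) u w) = ε * (v.1 * w.2 - v.2 * w.1) := by
  obtain ⟨d, hd, h0, h1, h2⟩ := fderiv_equalAreaChart ε hu v
  obtain ⟨d', hd', h0', h1', h2'⟩ := fderiv_equalAreaChart ε hu w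
  have hs : √(1 - (u.1 ^ 2 + u.2 ^ 2) / 4) ^ 2 = 1 - (u.1 ^ 2 + u.2 ^ 2) / 4 :=
    Real.sq_sqrt (by linarith)
  simp only [sphereAreaForm, cross_apply, Matrix.vec3_dotProduct, Matrix.cons_val_zero,
    Matrix.cons_val_one, Matrix.cons_val, h0, h1, h2, h0', h1', h2']
  simp only [equalAreaChart, Matrix.cons_val_zero, Matrix.cons_val_one, Matrix.cons_val]
  generalize √(1 - (u.1 ^ 2 + u.2 ^ 2) / 4) = s at *
  obtain ⟨X, Y⟩ := u
  obtain ⟨a, b⟩ := v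
  obtain ⟨a', b'⟩ := w
  simp only at *
  -- Regrouped so that the root and its derivatives occur only through `s ^ 2`, `s * d` and `s *
  -- d'`, which are polynomial.
  have e : (X * s) * ((b * s + Y * d) * (-ε * (X * a' + Y * b')) -
      (-ε * (X * a + Y * b)) * (b' * s + Y * d')) +
    (Y * s) * ((-ε * (X * a + Y * b)) * (a' * s + X * d') -
      (a * s + X * d) * (-ε * (X * a' + Y * b'))) +
    (ε * (1 - (X ^ 2 + Y ^ 2) / 2)) * ((a * s + X * d) * (b' * s + Y * d') -
      (b * s + Y * d) * (a' * s + X * d')) =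
    ε * (s ^ 2 * (X ^ 2 + Y ^ 2) + s ^ 2 * (1 - (X ^ 2 + Y ^ 2) / 2)) * (a * b' - b * a') +
    ε * (1 - (X ^ 2 + Y ^ 2) / 2) * ((s * d) * (X * b' - Y * a') -
      (s * d') * (X * b - Y * a)) := by ring
  refine e.trans ?_
  rw [hd, hd', hs]
  ring

/-! ### Symplectic coordinate changes and orders of vanishing -/

/-- A canonical parametrisation can be precomposed with a symplectic map fixing the origin. -/
theorem IsCanonicalParam.comp {R₁ R₂ : ℝ} {z : SpinSpace} {U : Set CanonicalSpace}
    {Ψ : CanonicalSpace → SpinSpace} (h : IsCanonicalParam R₁ R₂ z U Ψ)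
    {Φ : CanonicalSpace → CanonicalSpace} (hΦ : ContDiff ℝ ∞ Φ) (h0 : Φ 0 = 0)
    (hs : ∀ x v w, standardForm (fderiv ℝ Φ x v) (fderiv ℝ Φ x w) = standardForm v w) :
    IsCanonicalParam R₁ R₂ z (Φ ⁻¹' U) (fun x => Ψ (Φ x)) where
  isOpen := h.isOpen.preimage hΦ.continuous
  zero_mem := by simpa [h0] using h.zero_mem
  smooth := h.smooth.comp hΦ.contDiffOn (fun _ hx => hx)
  mapsTo _ hx := h.mapsTo hx
  map_zero := by rw [h0, h.map_zero]
  symplectic x hx v w := by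
    have hd : DifferentiableAt ℝ Ψ (Φ x) :=
      (h.smooth.contDiffAt (h.isOpen.mem_nhds hx)).differentiableAt (by simp)
    have hc : fderiv ℝ (fun x => Ψ (Φ x)) x = (fderiv ℝ Ψ (Φ x)).comp (fderiv ℝ Φ x) :=
      fderiv_comp x hd (hΦ.differentiable (by simp) x)
    rw [hc]
    exact (h.symplectic _ hx _ _).trans (hs x v w)

/-- The standard symplectic form with its first argument fixed. -/
noncomputable def standardFormCLM (v : CanonicalSpace) : CanonicalSpace →L[ℝ] ℝ :=
  LinearMap.toContinuousLinearMap
    { toFun := standardForm v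
      map_add' := fun x y => by simp only [standardForm, Prod.fst_add, Prod.snd_add, Pi.add_apply]; ring
      map_smul' := fun c x => by
        simp only [standardForm, Prod.smul_fst, Prod.smul_snd, Pi.smul_apply, smul_eq_mul,
          RingHom.id_apply]
        ring }

theorem standardFormCLM_apply (v x : CanonicalSpace) :
    standardFormCLM v x = standardForm v x := rfl

/-- The nonlinear symplectic transvection `x ↦ x + c ω(v, x)³ v`. -/
noncomputable def cubicTransvection (v : CanonicalSpace) (c : ℝ) (x : CanonicalSpace) :
    CanonicalSpace :=
  x + (c * standardFormCLM v x ^ 3) • v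

theorem contDiff_cubicTransvection (v : CanonicalSpace) (c : ℝ) :
    ContDiff ℝ ∞ (cubicTransvection v c) := by
  unfold cubicTransvection
  fun_prop

theorem cubicTransvection_zero (v : CanonicalSpace) (c : ℝ) : cubicTransvection v c 0 = 0 := by
  simp [cubicTransvection]

/-- The derivative at `x` is the identity plus 3cω(v, x)² ω(v, ·)v, a linear symplectic
transvection. The map is a Hamiltonian flow with generator proportional to ω(v, x)⁴, exact because
ω(v, x) is conserved. -/
theorem standardForm_fderiv_cubicTransvection (v : CanonicalSpace) (c : ℝ)
    (x y z : CanonicalSpace) :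
    standardForm (fderiv ℝ (cubicTransvection v c) x y)
      (fderiv ℝ (cubicTransvection v c) x z) = standardForm y z := by
  have hd : HasFDerivAt (cubicTransvection v c)
      (ContinuousLinearMap.id ℝ CanonicalSpace +
        (c • ((3 * standardFormCLM v x ^ 2) • standardFormCLM v)).smulRight v) x := by
    have h3 : HasFDerivAt (fun x => standardFormCLM v x ^ 3)
        ((3 * standardFormCLM v x ^ 2) • standardFormCLM v) x := by
      simpa using (standardFormCLM v).hasFDerivAt.pow 3
    exact (hasFDerivAt_id x).add ((h3.const_mul c).smul_const v)
  rw [hd.fderiv]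
  simp only [add_apply, ContinuousLinearMap.coe_id', id_eq,
    ContinuousLinearMap.smulRight_apply, smul_apply, smul_eq_mul,
    standardFormCLM_apply]
  simp only [standardForm, Prod.fst_add, Prod.snd_add, Pi.add_apply, Prod.smul_fst,
    Prod.smul_snd, Pi.smul_apply, smul_eq_mul]
  ring

theorem isBigO_norm_pow_of_le {m n : ℕ} (h : m ≤ n) :
    (fun x : CanonicalSpace => ‖x‖ ^ n) =O[𝓝 0] (fun x => ‖x‖ ^ m) := by
  refine Asymptotics.IsBigO.of_bound 1 ?_
  filter_upwards [Metric.ball_mem_nhds (0 : CanonicalSpace) one_pos] with x hx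
  rw [one_mul, norm_pow, norm_pow, norm_norm]
  exact pow_le_pow_of_le_one (norm_nonneg x) (mem_ball_zero_iff.1 hx).le h

/-- `f` vanishes to order `k` at the origin, and cubic transvections change it by terms of order
`k + 2`. -/
def IsTransvectionJet (k : ℕ) (f : CanonicalSpace → ℝ) : Prop :=
  f =O[𝓝 0] (fun x => ‖x‖ ^ k) ∧
    ∀ v c, (fun x => f (cubicTransvection v c x) - f x) =O[𝓝 0] (fun x => ‖x‖ ^ (k + 2))

theorem tendsto_cubicTransvection (v : CanonicalSpace) (c : ℝ) :
    Filter.Tendsto (cubicTransvection v c) (𝓝 0) (𝓝 0) := by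
  simpa [cubicTransvection_zero] using (contDiff_cubicTransvection v c).continuous.tendsto 0

theorem isBigO_standardFormCLM (v : CanonicalSpace) :
    (fun x => standardFormCLM v x) =O[𝓝 0] (fun x : CanonicalSpace => ‖x‖ ^ 1) := by
  simpa using ((standardFormCLM v).isBigO_id (𝓝 0)).norm_right

theorem isBigO_cubicTransvection (v : CanonicalSpace) (c : ℝ) :
    cubicTransvection v c =O[𝓝 0] (fun x => ‖x‖) := by
  have h := (contDiff_cubicTransvection v c).differentiable (by simp) 0
  simpa [cubicTransvection_zero] using h.isBigO_sub.norm_right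

namespace IsTransvectionJet

variable {j k : ℕ} {f g : CanonicalSpace → ℝ}

theorem add (hf : IsTransvectionJet k f) (hg : IsTransvectionJet k g) :
    IsTransvectionJet k (fun x => f x + g x) :=
  ⟨hf.1.add hg.1, fun v c => ((hf.2 v c).add (hg.2 v c)).congr_left fun x => by ring⟩

theorem const_mul (a : ℝ) (hf : IsTransvectionJet k f) :
    IsTransvectionJet k (fun x => a * f x) :=
  ⟨hf.1.const_mul_left a, fun v c => ((hf.2 v c).const_mul_left a).congr_left fun x => by ring⟩

theorem comp_isBigO (hf : IsTransvectionJet k f) (v : CanonicalSpace) (c : ℝ) :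
    (fun x => f (cubicTransvection v c x)) =O[𝓝 0] (fun x => ‖x‖ ^ k) :=
  (hf.1.comp_tendsto (tendsto_cubicTransvection v c)).trans
    ((isBigO_cubicTransvection v c).norm_left.pow k)

theorem mul (hf : IsTransvectionJet j f) (hg : IsTransvectionJet k g) :
    IsTransvectionJet (j + k) (fun x => f x * g x) := by
  refine ⟨(hf.1.mul hg.1).congr_right fun x => (pow_add _ _ _).symm, fun v c => ?_⟩
  have h1 := (hf.2 v c).mul (hg.comp_isBigO v c)
  have h2 := hf.1.mul (hg.2 v c)
  refine ((h1.congr_right (g₂ := fun x => ‖x‖ ^ (j + k + 2)) fun x => ?_).add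
    (h2.congr_right fun x => ?_)).congr_left fun x => ?_
  · ring
  · ring
  · ring

theorem clm (L : CanonicalSpace →L[ℝ] ℝ) : IsTransvectionJet 1 L := by
  refine ⟨by simpa using (L.isBigO_id (𝓝 0)).norm_right, fun v c => ?_⟩
  refine (((isBigO_standardFormCLM v).pow 3).const_mul_left (c * L v)).congr (fun x => ?_)
    fun x => ?_
  · simp [cubicTransvection]
    ring
  · ring

theorem fst (i : Fin 2) : IsTransvectionJet 1 (fun x => x.1 i) :=
  clm ((ContinuousLinearMap.proj i).comp (ContinuousLinearMap.fst ℝ _ _))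

theorem snd (i : Fin 2) : IsTransvectionJet 1 (fun x => x.2 i) :=
  clm ((ContinuousLinearMap.proj i).comp (ContinuousLinearMap.snd ℝ _ _))

theorem hilbertS : IsTransvectionJet 2 hilbertS := by
  have := ((fst 0).mul (snd 1)).add (((fst 1).mul (snd 0)).const_mul (-1))
  convert this using 2 with x
  simp only [_root_.hilbertS]
  ring

theorem hilbertM : IsTransvectionJet 2 hilbertM := by
  have := (((fst 0).mul (fst 0)).add ((fst 1).mul (fst 1))).const_mul (1 / 2)
  convert this using 2 with x
  simp only [_root_.hilbertM]
  ring

theorem hilbertN : IsTransvectionJet 2 hilbertN := by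
  have := (((snd 0).mul (snd 0)).add ((snd 1).mul (snd 1))).const_mul (1 / 2)
  convert this using 2 with x
  simp only [_root_.hilbertN]
  ring

end IsTransvectionJet

/-! ### Removing quartic terms -/

/-- In some canonical coordinates near `z`, the function `H` has the expansion
`ρ S + σ N + f` up to its constant term and terms of order five. -/
def HasExpansion (R₁ R₂ : ℝ) (H : SpinSpace → ℝ) (z : SpinSpace) (ρ σ : ℝ)
    (f : CanonicalSpace → ℝ) : Prop :=
  ∃ U Ψ, IsCanonicalParam R₁ R₂ z U Ψ ∧
    (fun x : CanonicalSpace => H (Ψ x) - H z - (ρ * hilbertS x + σ * hilbertN x + f x))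
      =O[𝓝 0] (fun x : CanonicalSpace => ‖x‖ ^ 5)

/-- The quartic terms `g` can be added to every quartic expansion by a change of coordinates. -/
def IsRemovable (ρ σ : ℝ) (g : CanonicalSpace → ℝ) : Prop :=
  IsTransvectionJet 4 g ∧ ∀ (R₁ R₂ : ℝ) (H : SpinSpace → ℝ) (z : SpinSpace)
    (f : CanonicalSpace → ℝ), IsTransvectionJet 4 f → HasExpansion R₁ R₂ H z ρ σ f →
    HasExpansion R₁ R₂ H z ρ σ (fun x => f x + g x)

theorem IsRemovable.add {ρ σ : ℝ} {g g' : CanonicalSpace → ℝ} (h : IsRemovable ρ σ g)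
    (h' : IsRemovable ρ σ g') : IsRemovable ρ σ (fun x => g x + g' x) := by
  refine ⟨h.1.add h'.1, fun R₁ R₂ H z f hf hH => ?_⟩
  have := h'.2 R₁ R₂ H z _ (hf.add h.1) (h.2 R₁ R₂ H z f hf hH)
  simpa only [add_assoc] using this

/-- The polar form of `ρ S + σ N`. -/
def hopfPolar (ρ σ : ℝ) (v x : CanonicalSpace) : ℝ :=
  ρ * (v.1 0 * x.2 1 - v.1 1 * x.2 0 + x.1 0 * v.2 1 - x.1 1 * v.2 0) +
    σ * (v.2 0 * x.2 0 + v.2 1 * x.2 1)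

/-- For Q = ρS + σN with polar form B, Q(x + λv) = Q(x) + λB(v, x) + λ²Q(v). With λ = cω(v, x)³ the
middle term is the new quartic and the last has order six; existing quartic terms also change only
at order six. -/
theorem isRemovable_transvection (ρ σ : ℝ) (v : CanonicalSpace) (c : ℝ) :
    IsRemovable ρ σ (fun x => c * (standardForm v x ^ 3 * hopfPolar ρ σ v x)) := by
  have hJ : IsTransvectionJet 4 (fun x => c * (standardForm v x ^ 3 * hopfPolar ρ σ v x)) := by
    have hω := IsTransvectionJet.clm (standardFormCLM v)
    have hB : IsTransvectionJet 1 (hopfPolar ρ σ v) := by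
      have := (((IsTransvectionJet.snd 0).const_mul (-ρ * v.1 1 + σ * v.2 0)).add
        ((IsTransvectionJet.snd 1).const_mul (ρ * v.1 0 + σ * v.2 1))).add
        (((IsTransvectionJet.fst 0).const_mul (ρ * v.2 1)).add
        ((IsTransvectionJet.fst 1).const_mul (-ρ * v.2 0)))
      convert this using 2 with x
      simp only [hopfPolar]
      ring
    have := (((hω.mul hω).mul hω).mul hB).const_mul c
    convert this using 2 with x
    simp only [standardFormCLM_apply]
    ring
  refine ⟨hJ, ?_⟩
  rintro R₁ R₂ H z f hf ⟨U, Ψ, hΨ, hO⟩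
  refine ⟨_, _, hΨ.comp (contDiff_cubicTransvection v c) (cubicTransvection_zero v c)
    (standardForm_fderiv_cubicTransvection v c), ?_⟩
  have h1 := (hO.comp_tendsto (tendsto_cubicTransvection v c)).trans
    ((isBigO_cubicTransvection v c).norm_left.pow 5)
  have h56 := isBigO_norm_pow_of_le (show 5 ≤ 6 by norm_num)
  have h2 := (hf.2 v c).trans h56
  have h3 := (((isBigO_standardFormCLM v).pow 6).const_mul_left
    (c ^ 2 * (ρ * hilbertS v + σ * hilbertN v))).congr_right
    (g₂ := fun x : CanonicalSpace => ‖x‖ ^ 6) (fun x => by ring)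
  refine ((h1.add h2).add (h3.trans h56)).congr_left fun x => ?_
  simp only [Function.comp, cubicTransvection, standardFormCLM_apply, hilbertS, hilbertN, hopfPolar,
    Prod.fst_add, Prod.snd_add, Pi.add_apply, Prod.smul_fst, Prod.smul_snd, Pi.smul_apply,
    smul_eq_mul]
  ring

/-- The invariant `q₁ p₁ + q₂ p₂`. -/
def hilbertD (x : CanonicalSpace) : ℝ := x.1 0 * x.2 0 + x.1 1 * x.2 1

/-- The identity 4a⁴ + 4b⁴ + (a + b)⁴ + (a - b)⁴ = 6(a² + b²)² makes the generator a multiple of |q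
+ sp|⁴. It is rotation invariant, so `ρ` drops out, and σN acts on it as a multiple of d/ds. -/
theorem isRemovable_radial (ρ σ s c : ℝ) :
    IsRemovable ρ σ (fun x => 12 * c * σ * ((hilbertM x + s * hilbertD x + s ^ 2 * hilbertN x) *
      (hilbertD x + 2 * s * hilbertN x))) := by
  have h := (isRemovable_transvection ρ σ (![s, 0], ![-1, 0]) (-4 * c))
    |>.add (isRemovable_transvection ρ σ (![0, s], ![0, -1]) (-4 * c))
    |>.add (isRemovable_transvection ρ σ (![s, s], ![-1, -1]) (-c))
    |>.add (isRemovable_transvection ρ σ (![s, -s], ![-1, 1]) (-c))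
  convert h using 2 with x
  simp only [standardForm, hopfPolar, hilbertM, hilbertN, hilbertD, Matrix.cons_val_zero,
    Matrix.cons_val_one]
  ring

/-- The radial term is MD + s(2MN + D²) + 3s²DN + 2s³N². Differences between s and -s keep the odd
powers, and combining s = 2 with s = 1 isolates the s³ coefficient. -/
theorem isRemovable_N_sq (ρ : ℝ) {σ : ℝ} (hσ : σ ≠ 0) (c : ℝ) :
    IsRemovable ρ σ (fun x => c * hilbertN x ^ 2) := by
  have h := (isRemovable_radial ρ σ 2 (c / (288 * σ)))
    |>.add (isRemovable_radial ρ σ (-2) (-(c / (288 * σ))))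
    |>.add (isRemovable_radial ρ σ 1 (-2 * (c / (288 * σ))))
    |>.add (isRemovable_radial ρ σ (-1) (2 * (c / (288 * σ))))
  convert h using 2 with x
  field_simp
  ring

/-- Once N² is subtracted, the odd part in s leaves 2MN + D², and D² = 4MN - S². So MN is not
removed outright but traded for S². -/
theorem isRemovable_MN (ρ : ℝ) {σ : ℝ} (hσ : σ ≠ 0) (c : ℝ) :
    IsRemovable ρ σ (fun x => c * (6 * (hilbertM x * hilbertN x) - hilbertS x ^ 2)) := by
  have h := (isRemovable_radial ρ σ 1 (c / (24 * σ)))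
    |>.add (isRemovable_radial ρ σ (-1) (-(c / (24 * σ))))
    |>.add (isRemovable_N_sq ρ hσ (-2 * c))
  convert h using 2 with x
  field_simp
  simp only [hilbertM, hilbertN, hilbertD, hilbertS]
  ring

/-- The generator is a multiple of SD: the flow of N fixes S and sends D to 2N at first order, while
S commutes with SD. The sixteen vectors write SD as a signed sum of fourth powers of linear forms.
-/
theorem isRemovable_SN (ρ : ℝ) {σ : ℝ} (hσ : σ ≠ 0) (c : ℝ) :
    IsRemovable ρ σ (fun x => c * (hilbertS x * hilbertN x)) := by
  suffices H : ∀ c, IsRemovable ρ σ (fun x => -24 * c * σ * (hilbertS x * hilbertN x)) by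
    convert H (-(c / (24 * σ))) using 2 with x
    field_simp
  clear c
  intro c
  have h := (isRemovable_transvection ρ σ (![1, 1], ![-1, 0]) c)
    |>.add (isRemovable_transvection ρ σ (![1, 1], ![1, 0]) c)
    |>.add (isRemovable_transvection ρ σ (![1, -1], ![-1, 0]) (-c))
    |>.add (isRemovable_transvection ρ σ (![1, -1], ![1, 0]) (-c))
    |>.add (isRemovable_transvection ρ σ (![1, 1], ![0, -1]) (-c))
    |>.add (isRemovable_transvection ρ σ (![1, 1], ![0, 1]) (-c))
    |>.add (isRemovable_transvection ρ σ (![1, -1], ![0, -1]) c)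
    |>.add (isRemovable_transvection ρ σ (![1, -1], ![0, 1]) c)
    |>.add (isRemovable_transvection ρ σ (![0, 1], ![-1, -1]) c)
    |>.add (isRemovable_transvection ρ σ (![0, -1], ![-1, -1]) c)
    |>.add (isRemovable_transvection ρ σ (![0, 1], ![-1, 1]) (-c))
    |>.add (isRemovable_transvection ρ σ (![0, -1], ![-1, 1]) (-c))
    |>.add (isRemovable_transvection ρ σ (![1, 0], ![-1, -1]) (-c))
    |>.add (isRemovable_transvection ρ σ (![-1, 0], ![-1, -1]) (-c))
    |>.add (isRemovable_transvection ρ σ (![1, 0], ![-1, 1]) c)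
    |>.add (isRemovable_transvection ρ σ (![-1, 0], ![-1, 1]) c)
  convert h using 2 with x
  simp only [standardForm, hopfPolar, hilbertN, hilbertS, Matrix.cons_val_zero,
    Matrix.cons_val_one]
  ring

/-- Quartic polynomials in the Hilbert generators `S, M, N` can be brought into normal form
without changing the coefficient of `M ^ 2`. -/
theorem HasExpansion.hasHopfNormalForm {R₁ R₂ : ℝ} {H : SpinSpace → ℝ} {z : SpinSpace}
    {ρ σ a b c d e f : ℝ} (hσ : σ ≠ 0)
    (h : HasExpansion R₁ R₂ H z ρ σ (fun x => a * hilbertM x ^ 2 +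
      b * (hilbertM x * hilbertS x) + c * hilbertS x ^ 2 + d * (hilbertM x * hilbertN x) +
      e * hilbertN x ^ 2 + f * (hilbertS x * hilbertN x))) :
    HasHopfNormalForm R₁ R₂ H z ρ σ a := by
  have hS := IsTransvectionJet.hilbertS
  have hM := IsTransvectionJet.hilbertM
  have hN := IsTransvectionJet.hilbertN
  -- Cancelling d·MN contributes d/6 to the coefficient of S².
  have hr := (isRemovable_MN ρ hσ (-d / 6)).add ((isRemovable_N_sq ρ hσ (-e)).add
    (isRemovable_SN ρ hσ (-f)))
  obtain ⟨U, Ψ, hΨ, hO⟩ := hr.2 R₁ R₂ H z _ (by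
    simp only [pow_two]
    exact ((((((hM.mul hM).const_mul a).add ((hM.mul hS).const_mul b)).add
      ((hS.mul hS).const_mul c)).add ((hM.mul hN).const_mul d)).add
      ((hN.mul hN).const_mul e)).add ((hS.mul hN).const_mul f)) h
  refine ⟨U, Ψ, hΨ, b, c + d / 6, hO.congr_left fun x => ?_⟩
  ring

/-! ### The rank zero singularity -/

theorem pointM0_mem_phaseSpace : pointM0 ∈ phaseSpace := by
  constructor <;>
  · rw [mem_sphere_zero_iff_norm, EuclideanSpace.norm_eq, Real.sqrt_eq_one]
    simp [pointM0, Fin.sum_univ_three]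

/-- At a pole of the sphere, the height has zero differential along every map to the sphere. -/
theorem hasFDerivAt_height_eq_zero {E : Type*} [NormedAddCommGroup E] [NormedSpace ℝ E]
    {g : E → Space3} {x : E} {D : E →L[ℝ] Space3} (hg : HasFDerivAt g D x)
    (hsphere : ∀ᶠ y in 𝓝 x, g y ∈ Metric.sphere (0 : Space3) 1)
    (h0 : g x 0 = 0) (h1 : g x 1 = 0) (h2 : g x 2 ≠ 0) :
    HasFDerivAt (fun y => g y 2) (0 : E →L[ℝ] ℝ) x := by
  have hc (i : Fin 3) := (EuclideanSpace.proj (𝕜 := ℝ) i).hasFDerivAt.comp x hg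
  -- Differentiating x² + y² + z² = 1 where x = y = 0 leaves 2z dz = 0.
  have hsum := (((hc 0).pow 2).add ((hc 1).pow 2)).add ((hc 2).pow 2)
  have hconst : HasFDerivAt (fun _ : E => (1 : ℝ)) (0 : E →L[ℝ] ℝ) x := hasFDerivAt_const _ _
  have hz := hsum.unique (hconst.congr_of_eventuallyEq (by
    filter_upwards [hsphere] with y hy
    rw [mem_sphere_zero_iff_norm, EuclideanSpace.norm_eq, Real.sqrt_eq_one] at hy
    simpa [Fin.sum_univ_three] using hy))
  refine (hc 2).congr_fderiv ?_
  ext v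
  have := DFunLike.congr_fun hz v
  simpa [h0, h1, h2] using this

theorem isRankZeroSingularity_pointM0 (R₁ R₂ w t₀ t₁ t₂ t₃ t₄ : ℝ) :
    IsRankZeroSingularity R₁ R₂ (gaudinMomentumMap R₁ R₂ w t₀ t₁ t₂ t₃ t₄) pointM0 := by
  refine ⟨pointM0_mem_phaseSpace, fun U Ψ hΨ => ?_⟩
  have hU := hΨ.isOpen.mem_nhds hΨ.zero_mem
  have hD := ((hΨ.smooth.contDiffAt hU).differentiableAt (by simp)).hasFDerivAt
  have hfst := hD.fst
  have hsnd := hD.snd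
  have hx1 := (EuclideanSpace.proj (𝕜 := ℝ) (0 : Fin 3)).hasFDerivAt.comp 0 hfst
  have hy1 := (EuclideanSpace.proj (𝕜 := ℝ) (1 : Fin 3)).hasFDerivAt.comp 0 hfst
  have hx2 := (EuclideanSpace.proj (𝕜 := ℝ) (0 : Fin 3)).hasFDerivAt.comp 0 hsnd
  have hy2 := (EuclideanSpace.proj (𝕜 := ℝ) (1 : Fin 3)).hasFDerivAt.comp 0 hsnd
  have hz1 : HasFDerivAt (fun x => (Ψ x).1 2) (0 : CanonicalSpace →L[ℝ] ℝ) 0 :=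
    hasFDerivAt_height_eq_zero hfst
      (by filter_upwards [hU] with y hy using (hΨ.mapsTo hy).1)
      (by simp [hΨ.map_zero, pointM0]) (by simp [hΨ.map_zero, pointM0])
      (by simp [hΨ.map_zero, pointM0])
  have hz2 : HasFDerivAt (fun x => (Ψ x).2 2) (0 : CanonicalSpace →L[ℝ] ℝ) 0 :=
    hasFDerivAt_height_eq_zero hsnd
      (by filter_upwards [hU] with y hy using (hΨ.mapsTo hy).2)
      (by simp [hΨ.map_zero, pointM0]) (by simp [hΨ.map_zero, pointM0])
      (by simp [hΨ.map_zero, pointM0])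
  have hJ := (hz1.const_mul R₁).add (hz2.const_mul R₂)
  have hH := ((((hz1.add hz2).pow 2).const_mul t₀).add
    (((hz1.const_mul t₁).add (hz2.const_mul t₂)).const_mul w)).add
    (((hx1.mul hx2).add (hy1.mul hy2)).const_mul t₃) |>.add ((hz1.mul hz2).const_mul t₄)
  refine (hJ.prodMk hH).congr_fderiv ?_
  ext v <;> simp [hΨ.map_zero, pointM0]

/-! ### Canonical coordinates at the singularity -/

/-- The linear map `x ↦ a (Q - i c P)` in the complex notation `Q = q₁ + i q₂`, `P = p₁ + i p₂`. -/
noncomputable def complexCombination (a c : ℝ) : CanonicalSpace →L[ℝ] ℝ × ℝ :=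
  LinearMap.toContinuousLinearMap
    { toFun := fun x => (a * (x.1 0 + c * x.2 1), a * (x.1 1 - c * x.2 0))
      map_add' := fun x y => by
        ext <;> simp only [Prod.fst_add, Prod.snd_add, Pi.add_apply] <;> ring
      map_smul' := fun r x => by
        ext <;> simp only [Prod.smul_fst, Prod.smul_snd, Pi.smul_apply, smul_eq_mul,
          RingHom.id_apply] <;> ring }

theorem complexCombination_fst (a c : ℝ) (x : CanonicalSpace) :
    (complexCombination a c x).1 = a * (x.1 0 + c * x.2 1) := rfl

theorem complexCombination_snd (a c : ℝ) (x : CanonicalSpace) :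
    (complexCombination a c x).2 = a * (x.1 1 - c * x.2 0) := rfl

/-- Canonical coordinates around `m₀` built from equal-area charts around the two poles. -/
noncomputable def polarChart (a₁ a₂ : ℝ) (x : CanonicalSpace) : SpinSpace :=
  (equalAreaChart 1 (complexCombination a₁ (-1) x), equalAreaChart (-1) (complexCombination a₂ 1 x))

/-- The domain of `polarChart`. -/
def polarDomain (a₁ a₂ : ℝ) : Set CanonicalSpace :=
  {x | (complexCombination a₁ (-1) x).1 ^ 2 + (complexCombination a₁ (-1) x).2 ^ 2 < 4 ∧
    (complexCombination a₂ 1 x).1 ^ 2 + (complexCombination a₂ 1 x).2 ^ 2 < 4}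

theorem isCanonicalParam_polarChart {R₁ R₂ a₁ a₂ : ℝ} (h₁ : 2 * R₁ * a₁ ^ 2 = 1)
    (h₂ : 2 * R₂ * a₂ ^ 2 = 1) :
    IsCanonicalParam R₁ R₂ pointM0 (polarDomain a₁ a₂) (polarChart a₁ a₂) where
  isOpen := by
    have hc (a c : ℝ) : Continuous fun x =>
        (complexCombination a c x).1 ^ 2 + (complexCombination a c x).2 ^ 2 := by fun_prop
    exact (isOpen_lt (hc a₁ (-1)) continuous_const).inter
      (isOpen_lt (hc a₂ 1) continuous_const)
  zero_mem := by simp [polarDomain]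
  smooth x hx := by
    refine ContDiffAt.contDiffWithinAt ?_
    exact ((contDiffAt_equalAreaChart 1 hx.1).comp x
      (complexCombination a₁ (-1)).contDiff.contDiffAt).prodMk
      ((contDiffAt_equalAreaChart (-1) hx.2).comp x
      (complexCombination a₂ 1).contDiff.contDiffAt)
  mapsTo x hx := ⟨equalAreaChart_mem_sphere (by norm_num) hx.1,
    equalAreaChart_mem_sphere (by norm_num) hx.2⟩
  map_zero := by simp [polarChart, equalAreaChart, pointM0]
  symplectic x hx v w := by
    have d₁ := (((contDiffAt_equalAreaChart 1 hx.1).differentiableAt (by simp)).hasFDerivAt).comp x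
      (complexCombination a₁ (-1)).hasFDerivAt
    have d₂ := (((contDiffAt_equalAreaChart (-1) hx.2).differentiableAt
      (by simp)).hasFDerivAt).comp x (complexCombination a₂ 1).hasFDerivAt
    have hd : fderiv ℝ (polarChart a₁ a₂) x = _ := (d₁.prodMk d₂).fderiv
    rw [hd]
    have e₁ := sphereAreaForm_equalAreaChart 1 hx.1 (complexCombination a₁ (-1) v)
      (complexCombination a₁ (-1) w)
    have e₂ := sphereAreaForm_equalAreaChart (-1) hx.2 (complexCombination a₂ 1 v)
      (complexCombination a₂ 1 w)
    refine (congrArg₂ (fun s t => R₁ * s + R₂ * t) e₁ e₂).trans ?_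
    simp only [complexCombination_fst, complexCombination_snd, standardForm]
    -- The opposite orientations at the two poles cancel the dq₁ ∧ dq₂ and dp₁ ∧ dp₂ parts, and the
    -- mixed parts add up.
    linear_combination (1 / 2 * ((v.1 0 - v.2 1) * (w.1 1 + w.2 0)
      - (v.1 1 + v.2 0) * (w.1 0 - w.2 1))) * h₁ -
      (1 / 2 * ((v.1 0 + v.2 1) * (w.1 1 - w.2 0) - (v.1 1 - v.2 0) * (w.1 0 + w.2 1))) * h₂

theorem isBigO_sqrt_one_sub :
    (fun u : ℝ => √(1 - u) - (1 - u / 2)) =O[𝓝 0] (fun u => u ^ 2) := by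
  refine Asymptotics.IsBigO.of_bound 1 ?_
  filter_upwards [gt_mem_nhds (zero_lt_one' ℝ)] with u hu
  have hs : √(1 - u) ^ 2 = 1 - u := Real.sq_sqrt (by linarith)
  have h0 := Real.sqrt_nonneg (1 - u)
  generalize √(1 - u) = s at *
  -- In terms of s the error is -(1 - s)²/2, whereas u² = (1 - s)²(1 + s)².
  obtain rfl : u = 1 - s ^ 2 := by linarith
  rw [one_mul, Real.norm_eq_abs, Real.norm_of_nonneg (sq_nonneg (1 - s ^ 2)), abs_le]
  constructor <;> nlinarith [sq_nonneg (1 - s), mul_nonneg (sq_nonneg (1 - s)) h0,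
    mul_nonneg (sq_nonneg (1 - s)) (mul_nonneg h0 h0)]

/-! ### Taylor expansion of the Hamiltonian -/

/-- Half the squared distance to the pole of the first sphere in the equal-area chart. -/
noncomputable def northAction (a₁ : ℝ) (x : CanonicalSpace) : ℝ :=
  a₁ ^ 2 * (hilbertM x + hilbertN x - hilbertS x)

/-- Half the squared distance to the pole of the second sphere in the equal-area chart. -/
noncomputable def southAction (a₂ : ℝ) (x : CanonicalSpace) : ℝ :=
  a₂ ^ 2 * (hilbertM x + hilbertN x + hilbertS x)

/-- The planar chart vectors are a₁(Q + iP) and a₂(Q - iP), whose inner product is 2a₁a₂(M - N); the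
heights depend only on the two actions. -/
theorem gaudinH_polarChart (a₁ a₂ w t₀ t₁ t₂ t₃ t₄ : ℝ) (x : CanonicalSpace) :
    gaudinH w t₀ t₁ t₂ t₃ t₄ (polarChart a₁ a₂ x) - gaudinH w t₀ t₁ t₂ t₃ t₄ pointM0 =
      t₀ * (southAction a₂ x - northAction a₁ x) ^ 2 +
      w * (t₂ * southAction a₂ x - t₁ * northAction a₁ x) +
      2 * a₁ * a₂ * t₃ * (hilbertM x - hilbertN x) *
        (√(1 - northAction a₁ x / 2) * √(1 - southAction a₂ x / 2)) +
      t₄ * (northAction a₁ x + southAction a₂ x - northAction a₁ x * southAction a₂ x) := by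
  have e₁ : ((complexCombination a₁ (-1) x).1 ^ 2 + (complexCombination a₁ (-1) x).2 ^ 2) =
      2 * northAction a₁ x := by
    simp only [complexCombination_fst, complexCombination_snd, northAction, hilbertM, hilbertN,
      hilbertS]
    ring
  have e₂ : ((complexCombination a₂ 1 x).1 ^ 2 + (complexCombination a₂ 1 x).2 ^ 2) =
      2 * southAction a₂ x := by
    simp only [complexCombination_fst, complexCombination_snd, southAction, hilbertM, hilbertN,
      hilbertS]
    ring
  have f₁ : 1 - 2 * northAction a₁ x / 4 = 1 - northAction a₁ x / 2 := by ring
  have f₂ : 1 - 2 * southAction a₂ x / 4 = 1 - southAction a₂ x / 2 := by ring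
  simp only [gaudinH, polarChart, equalAreaChart, pointM0, e₁, e₂, f₁, f₂,
    Matrix.cons_val_zero, Matrix.cons_val_one, Matrix.cons_val]
  simp only [complexCombination_fst, complexCombination_snd, hilbertM, hilbertN]
  ring

/-- The quadratic part of the trigonometric Gaudin Hamiltonian in `polarChart`. -/
noncomputable def gaudinQuadratic (a₁ a₂ t₃ t₄ : ℝ) (x : CanonicalSpace) : ℝ :=
  2 * a₁ * a₂ * t₃ * (hilbertM x - hilbertN x) + t₄ * (northAction a₁ x + southAction a₂ x)

/-- The quartic part of the trigonometric Gaudin Hamiltonian in `polarChart`. -/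
noncomputable def gaudinQuartic (a₁ a₂ t₀ t₃ t₄ : ℝ) (x : CanonicalSpace) : ℝ :=
  t₀ * (southAction a₂ x - northAction a₁ x) ^ 2 -
    2 * a₁ * a₂ * t₃ * (hilbertM x - hilbertN x) * (northAction a₁ x + southAction a₂ x) / 4 -
    t₄ * (northAction a₁ x * southAction a₂ x)

theorem isTransvectionJet_northAction (a : ℝ) : IsTransvectionJet 2 (northAction a) := by
  have := ((IsTransvectionJet.hilbertM.add IsTransvectionJet.hilbertN).add
    (IsTransvectionJet.hilbertS.const_mul (-1))).const_mul (a ^ 2)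
  convert this using 2 with x
  simp only [northAction]
  ring

theorem isTransvectionJet_southAction (a : ℝ) : IsTransvectionJet 2 (southAction a) :=
  ((IsTransvectionJet.hilbertM.add IsTransvectionJet.hilbertN).add
    IsTransvectionJet.hilbertS).const_mul (a ^ 2)

theorem isBigO_gaudinQuartic (a₁ a₂ t₀ t₃ t₄ : ℝ) :
    gaudinQuartic a₁ a₂ t₀ t₃ t₄ =O[𝓝 0] (fun x => ‖x‖ ^ 4) := by
  have hA := isTransvectionJet_northAction a₁
  have hB := isTransvectionJet_southAction a₂
  have hBA := hB.add (hA.const_mul (-1))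
  have hMN := IsTransvectionJet.hilbertM.add (IsTransvectionJet.hilbertN.const_mul (-1))
  refine ((((hBA.mul hBA).const_mul t₀).add
    ((hMN.mul (hA.add hB)).const_mul (-(2 * a₁ * a₂ * t₃ / 4)))).add
    ((hA.mul hB).const_mul (-t₄))).1.congr_left fun x => ?_
  simp only [gaudinQuartic]
  ring

theorem isBigO_sqrt_action {A : CanonicalSpace → ℝ} (hA : A =O[𝓝 0] (fun x => ‖x‖ ^ 2)) :
    (fun x => √(1 - A x / 2) - (1 - A x / 4)) =O[𝓝 0] (fun x => ‖x‖ ^ 4) := by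
  have ht : Filter.Tendsto (fun x => A x / 2) (𝓝 0) (𝓝 0) := by
    have h := hA.trans_tendsto (show Filter.Tendsto (fun x : CanonicalSpace => ‖x‖ ^ 2) (𝓝 0) (𝓝 0)
      by
        have hc : Continuous fun x : CanonicalSpace => ‖x‖ ^ 2 := by fun_prop
        simpa using hc.tendsto 0)
    simpa using h.div_const 2
  have hA2 : (fun x => A x / 2) =O[𝓝 0] (fun x => ‖x‖ ^ 2) :=
    (hA.const_mul_left (1 / 2)).congr_left fun x => by ring
  exact ((isBigO_sqrt_one_sub.comp_tendsto ht).trans (hA2.pow 2)).congr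
    (fun x => by simp only [Function.comp]; ring) (fun x => by ring)

/-- The Taylor expansion of the trigonometric Gaudin Hamiltonian at `m₀`. -/
theorem isBigO_gaudinH_polarChart (a₁ a₂ t₀ t₁ t₂ t₃ t₄ : ℝ) :
    (fun x => gaudinH 0 t₀ t₁ t₂ t₃ t₄ (polarChart a₁ a₂ x) - gaudinH 0 t₀ t₁ t₂ t₃ t₄ pointM0 -
      (gaudinQuadratic a₁ a₂ t₃ t₄ x + gaudinQuartic a₁ a₂ t₀ t₃ t₄ x))
      =O[𝓝 0] (fun x => ‖x‖ ^ 5) := by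
  have hA := isTransvectionJet_northAction a₁
  have hB := isTransvectionJet_southAction a₂
  have hMN := IsTransvectionJet.hilbertM.add (IsTransvectionJet.hilbertN.const_mul (-1))
  have eA := isBigO_sqrt_action hA.1
  have eB := isBigO_sqrt_action hB.1
  have h4 : (fun x : CanonicalSpace => ‖x‖ ^ 4) =O[𝓝 0] (fun x => ‖x‖ ^ 0) :=
    isBigO_norm_pow_of_le (by norm_num)
  have h2 : (fun x : CanonicalSpace => ‖x‖ ^ 2) =O[𝓝 0] (fun x => ‖x‖ ^ 0) :=
    isBigO_norm_pow_of_le (by norm_num)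
  have h1 : (fun _ : CanonicalSpace => (1 : ℝ)) =O[𝓝 0] (fun x => ‖x‖ ^ 0) := by
    simpa using Asymptotics.isBigO_refl (fun _ : CanonicalSpace => (1 : ℝ)) (𝓝 0)
  have bA : (fun x => 1 - northAction a₁ x / 4) =O[𝓝 0] (fun x => ‖x‖ ^ 0) :=
    (h1.add ((hA.1.trans h2).const_mul_left (-1 / 4))).congr_left fun x => by ring
  have bB : (fun x => 1 - southAction a₂ x / 4) =O[𝓝 0] (fun x => ‖x‖ ^ 0) :=
    (h1.add ((hB.1.trans h2).const_mul_left (-1 / 4))).congr_left fun x => by ring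
  have sB : (fun x => √(1 - southAction a₂ x / 2)) =O[𝓝 0] (fun x => ‖x‖ ^ 0) :=
    ((eB.trans h4).add bB).congr_left fun x => by ring
  have key : (fun x => (√(1 - northAction a₁ x / 2) * √(1 - southAction a₂ x / 2) -
      (1 - (northAction a₁ x + southAction a₂ x) / 4))) =O[𝓝 0] (fun x => ‖x‖ ^ 4) := by
    have k1 := (eA.mul sB).congr_right (g₂ := fun x => ‖x‖ ^ 4) (fun x => by ring)
    have k2 := (bA.mul eB).congr_right (g₂ := fun x => ‖x‖ ^ 4) (fun x => by ring)
    refine ((k1.add k2).add ((hA.mul hB).1.const_mul_left (1 / 16))).congr_left fun x => ?_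
    ring
  have h6 := ((hMN.1.mul key).const_mul_left (2 * a₁ * a₂ * t₃)).congr_right
    (g₂ := fun x => ‖x‖ ^ 6) (fun x => by ring)
  refine (h6.trans (isBigO_norm_pow_of_le (by norm_num))).congr_left fun x => ?_
  rw [gaudinH_polarChart]
  simp only [gaudinQuadratic, gaudinQuartic]
  ring

/-! ### Unfolding and normal form -/

/-- The linear symplectic map `(q, p) ↦ (l q, l⁻¹ p)`. -/
noncomputable def hyperbolicScaling (l : ℝ) : CanonicalSpace →L[ℝ] CanonicalSpace :=
  l • (ContinuousLinearMap.inl ℝ (Fin 2 → ℝ) (Fin 2 → ℝ)).comp (ContinuousLinearMap.fst ℝ _ _) +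
    l⁻¹ • (ContinuousLinearMap.inr ℝ (Fin 2 → ℝ) (Fin 2 → ℝ)).comp (ContinuousLinearMap.snd ℝ _ _)

theorem hyperbolicScaling_apply (l : ℝ) (x : CanonicalSpace) :
    hyperbolicScaling l x = (l • x.1, l⁻¹ • x.2) := by
  simp [hyperbolicScaling]

theorem standardForm_hyperbolicScaling {l : ℝ} (hl : l ≠ 0) (v w : CanonicalSpace) :
    standardForm (hyperbolicScaling l v) (hyperbolicScaling l w) = standardForm v w := by
  simp only [hyperbolicScaling_apply, standardForm, Pi.smul_apply, smul_eq_mul]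
  field_simp

theorem hilbertM_hyperbolicScaling (l : ℝ) (x : CanonicalSpace) :
    hilbertM (hyperbolicScaling l x) = l ^ 2 * hilbertM x := by
  simp only [hyperbolicScaling_apply, hilbertM, Pi.smul_apply, smul_eq_mul]
  ring

theorem hilbertN_hyperbolicScaling (l : ℝ) (x : CanonicalSpace) :
    hilbertN (hyperbolicScaling l x) = hilbertN x / l ^ 2 := by
  simp only [hyperbolicScaling_apply, hilbertN, Pi.smul_apply, smul_eq_mul]
  ring

theorem hilbertS_hyperbolicScaling {l : ℝ} (hl : l ≠ 0) (x : CanonicalSpace) :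
    hilbertS (hyperbolicScaling l x) = hilbertS x := by
  simp only [hyperbolicScaling_apply, hilbertS, Pi.smul_apply, smul_eq_mul]
  field_simp

theorem isBigO_hyperbolicScaling_comp {f : CanonicalSpace → ℝ} {k : ℕ}
    (hf : f =O[𝓝 0] (fun x => ‖x‖ ^ k)) (l : ℝ) :
    (fun x => f (hyperbolicScaling l x)) =O[𝓝 0] (fun x => ‖x‖ ^ k) :=
  (hf.comp_tendsto (by simpa using (hyperbolicScaling l).continuous.tendsto 0)).trans
    (((hyperbolicScaling l).isBigO_id (𝓝 0)).norm_left.norm_right.pow k)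

/-- The choice of l² turns the N coefficient κ + t₄e into σ; the M coefficient is then multiplied by
l², giving a difference of squares that is smooth in t₄. -/
theorem gaudinQuadratic_hyperbolicScaling (a₁ a₂ t₃ t₄ σ : ℝ) (hσ : σ ^ 2 = 1) {l : ℝ}
    (hl : l ≠ 0) (h : l ^ 2 = σ * (-2 * a₁ * a₂ * t₃ + t₄ * (a₁ ^ 2 + a₂ ^ 2)))
    (x : CanonicalSpace) :
    gaudinQuadratic a₁ a₂ t₃ t₄ (hyperbolicScaling l x) =
      t₄ * (a₂ ^ 2 - a₁ ^ 2) * hilbertS x + σ * hilbertN x -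
        σ * ((-2 * a₁ * a₂ * t₃) ^ 2 - (t₄ * (a₁ ^ 2 + a₂ ^ 2)) ^ 2) * hilbertM x := by
  have h2 : -2 * a₁ * a₂ * t₃ + t₄ * (a₁ ^ 2 + a₂ ^ 2) = σ * l ^ 2 := by
    linear_combination (-σ) * h - (-2 * a₁ * a₂ * t₃ + t₄ * (a₁ ^ 2 + a₂ ^ 2)) * hσ
  simp only [gaudinQuadratic, northAction, southAction, hilbertM_hyperbolicScaling,
    hilbertN_hyperbolicScaling, hilbertS_hyperbolicScaling hl]
  have h3 : hilbertN x / l ^ 2 * l ^ 2 = hilbertN x := by field_simp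
  linear_combination hilbertN x / l ^ 2 * h2 + σ * h3 +
    (t₄ * (a₁ ^ 2 + a₂ ^ 2) + 2 * a₁ * a₂ * t₃) * hilbertM x * h

section Bifurcation

variable {R₁ R₂ a₁ a₂ σ t₃ t₄ : ℝ}

theorem hasLinearHopfUnfolding_gaudin (h₁ : 2 * R₁ * a₁ ^ 2 = 1) (h₂ : 2 * R₂ * a₂ ^ 2 = 1)
    (t₀ t₁ t₂ : ℝ) (hσ : σ = 1 ∨ σ = -1) (hκ : 0 < σ * (-2 * a₁ * a₂ * t₃))
    (ht₄ : t₄ * (a₁ ^ 2 + a₂ ^ 2) = -2 * a₁ * a₂ * t₃) :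
    HasLinearHopfUnfolding R₁ R₂ (gaudinH 0 t₀ t₁ t₂ t₃) pointM0 t₄
      (t₄ * (a₂ ^ 2 - a₁ ^ 2)) σ := by
  have hσ2 : σ ^ 2 = 1 := by rcases hσ with rfl | rfl <;> norm_num
  have ha₁ : a₁ ≠ 0 := by rintro rfl; simp at h₁
  have he : 0 < a₁ ^ 2 + a₂ ^ 2 := by positivity
  have hσt : 0 < σ * t₄ := by
    refine pos_of_mul_pos_left (b := a₁ ^ 2 + a₂ ^ 2) ?_ he.le
    rwa [mul_assoc, ht₄]
  -- Within distance |t₄| of t₄ = κ/e the parameter keeps the sign of κ, so the scaling factor stays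
  -- smooth and nonzero.
  have hpos : ∀ t ∈ Set.Ioo (t₄ - σ * t₄) (t₄ + σ * t₄),
      0 < σ * (-2 * a₁ * a₂ * t₃ + t * (a₁ ^ 2 + a₂ ^ 2)) := by
    rintro t ⟨ht, ht'⟩
    have hσt' : 0 < σ * t := by
      rcases hσ with rfl | rfl <;> linarith
    have := mul_pos hσt' he
    linarith
  refine ⟨_, _, isCanonicalParam_polarChart h₁ h₂, t₄ - σ * t₄, t₄ + σ * t₄,
    ⟨by linarith, by linarith⟩, fun t => (t - t₄) * (a₂ ^ 2 - a₁ ^ 2),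
    fun t => σ * ((-2 * a₁ * a₂ * t₃) ^ 2 - (t * (a₁ ^ 2 + a₂ ^ 2)) ^ 2),
    fun t => hyperbolicScaling (√(σ * (-2 * a₁ * a₂ * t₃ + t * (a₁ ^ 2 + a₂ ^ 2)))),
    by fun_prop, by fun_prop, ?_, by ring, by simp only [ht₄, sub_self, mul_zero], ?_, fun t ht => ?_⟩
  · have hsqrt : ContDiffOn ℝ ∞
        (fun t => √(σ * (-2 * a₁ * a₂ * t₃ + t * (a₁ ^ 2 + a₂ ^ 2))))
        (Set.Ioo (t₄ - σ * t₄) (t₄ + σ * t₄)) :=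
      ContDiffOn.sqrt (by fun_prop) fun t ht => (hpos t ht).ne'
    exact (hsqrt.smul contDiffOn_const).add
      ((hsqrt.inv fun t ht => (Real.sqrt_pos.2 (hpos t ht)).ne').smul contDiffOn_const)
  · have hd : HasDerivAt
        (fun t => σ * ((-2 * a₁ * a₂ * t₃) ^ 2 - (t * (a₁ ^ 2 + a₂ ^ 2)) ^ 2))
        (σ * -(2 * (t₄ * (a₁ ^ 2 + a₂ ^ 2)) * (a₁ ^ 2 + a₂ ^ 2))) t₄ := by
      refine ((((hasDerivAt_id t₄).mul_const (a₁ ^ 2 + a₂ ^ 2)).pow 2).const_sub _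
        |>.const_mul σ).congr_deriv ?_
      simp
    rw [hd.deriv]
    have : 0 < σ * t₄ * (a₁ ^ 2 + a₂ ^ 2) ^ 2 := by positivity
    intro h0
    linarith
  · have hl := (Real.sqrt_pos.2 (hpos t ht)).ne'
    refine ⟨standardForm_hyperbolicScaling hl, ?_⟩
    have h := isBigO_hyperbolicScaling_comp ((isBigO_gaudinH_polarChart a₁ a₂ t₀ t₁ t₂ t₃ t).trans
      (isBigO_norm_pow_of_le (show 3 ≤ 5 by norm_num)))
      (√(σ * (-2 * a₁ * a₂ * t₃ + t * (a₁ ^ 2 + a₂ ^ 2))))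
    have h' := isBigO_hyperbolicScaling_comp ((isBigO_gaudinQuartic a₁ a₂ t₀ t₃ t).trans
      (isBigO_norm_pow_of_le (show 3 ≤ 4 by norm_num)))
      (√(σ * (-2 * a₁ * a₂ * t₃ + t * (a₁ ^ 2 + a₂ ^ 2))))
    refine (h.add h').congr_left fun x => ?_
    rw [gaudinQuadratic_hyperbolicScaling a₁ a₂ t₃ t σ hσ2 hl (Real.sq_sqrt (hpos t ht).le) x]
    ring

theorem hasHopfNormalForm_gaudin (h₁ : 2 * R₁ * a₁ ^ 2 = 1) (h₂ : 2 * R₂ * a₂ ^ 2 = 1)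
    (t₀ t₁ t₂ : ℝ) (hσ : σ = 1 ∨ σ = -1) (hκ : 0 < σ * (-2 * a₁ * a₂ * t₃))
    (ht₄ : t₄ * (a₁ ^ 2 + a₂ ^ 2) = -2 * a₁ * a₂ * t₃) :
    HasHopfNormalForm R₁ R₂ (gaudinH 0 t₀ t₁ t₂ t₃ t₄) pointM0 (t₄ * (a₂ ^ 2 - a₁ ^ 2)) σ
      ((2 * (σ * (-2 * a₁ * a₂ * t₃))) ^ 2 * ((a₂ ^ 2 - a₁ ^ 2) ^ 2 * (t₀ + t₄ / 4))) := by
  have hσ2 : σ ^ 2 = 1 := by rcases hσ with rfl | rfl <;> norm_num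
  have hL : 0 < σ * (-2 * a₁ * a₂ * t₃ + t₄ * (a₁ ^ 2 + a₂ ^ 2)) := by
    rw [ht₄]
    linarith
  obtain ⟨l, hl, hl2⟩ : ∃ l : ℝ, l ≠ 0 ∧
      l ^ 2 = σ * (-2 * a₁ * a₂ * t₃ + t₄ * (a₁ ^ 2 + a₂ ^ 2)) :=
    ⟨_, (Real.sqrt_pos.2 hL).ne', Real.sq_sqrt hL.le⟩
  have hl2' : 2 * (σ * (-2 * a₁ * a₂ * t₃)) = l ^ 2 := by
    rw [hl2, ht₄]
    ring
  rw [hl2']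
  have hd (x : CanonicalSpace) : fderiv ℝ (hyperbolicScaling l) x = hyperbolicScaling l :=
    (hyperbolicScaling l).fderiv
  refine HasExpansion.hasHopfNormalForm (σ := σ)
    (b := l ^ 2 * (a₂ ^ 2 - a₁ ^ 2) * (2 * t₀ * (a₁ ^ 2 + a₂ ^ 2) - a₁ * a₂ * t₃ / 2))
    (c := t₀ * (a₁ ^ 2 + a₂ ^ 2) ^ 2 + t₄ * (a₁ ^ 2 * a₂ ^ 2))
    (d := 2 * t₀ * (a₂ ^ 2 - a₁ ^ 2) ^ 2 - 2 * t₄ * (a₁ ^ 2 * a₂ ^ 2))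
    (e := (t₀ * (a₂ ^ 2 - a₁ ^ 2) ^ 2 + a₁ * a₂ * t₃ * (a₁ ^ 2 + a₂ ^ 2) / 2 -
      t₄ * (a₁ ^ 2 * a₂ ^ 2)) / l ^ 4)
    (f := (a₂ ^ 2 - a₁ ^ 2) * (2 * t₀ * (a₁ ^ 2 + a₂ ^ 2) + a₁ * a₂ * t₃ / 2) / l ^ 2)
    (by rintro rfl; norm_num at hσ2)
    ⟨_, _, (isCanonicalParam_polarChart h₁ h₂).comp (hyperbolicScaling l).contDiff
      (map_zero _) (fun x v w => by rw [hd, standardForm_hyperbolicScaling hl]), ?_⟩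
  refine (isBigO_hyperbolicScaling_comp (isBigO_gaudinH_polarChart a₁ a₂ t₀ t₁ t₂ t₃ t₄)
    l).congr_left fun x => ?_
  rw [gaudinQuadratic_hyperbolicScaling a₁ a₂ t₃ t₄ σ hσ2 hl hl2 x, ht₄]
  simp only [gaudinQuartic, northAction, southAction, hilbertM_hyperbolicScaling,
    hilbertN_hyperbolicScaling, hilbertS_hyperbolicScaling hl]
  have hq : hilbertN x = l ^ 2 * (hilbertN x / l ^ 2) := by field_simp
  generalize hilbertN x / l ^ 2 = n at hq
  rw [hq]
  field_simp
  -- Only the M² coefficient needs the critical relation: κe/4 - t₄a₁²a₂² becomes t₄(e² - 4a₁²a₂²)/4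
  -- = t₄(a₂² - a₁²)²/4.
  linear_combination (2 * (a₁ ^ 2 + a₂ ^ 2) * hilbertM x ^ 2 * l ^ 4) * ht₄

end Bifurcation

/-! ### Signs of the parameters -/

theorem corollary5p2 (R₁ R₂ : ℝ) (hR₁ : 0 < R₁) (hR₂ : 0 < R₂) (hR : R₁ ≠ R₂)
    (t₀ t₁ t₂ t₃ : ℝ)
    (h : (2 * (R₁ + R₂) * t₀ > -(√(R₁ * R₂) * t₃) ∧ t₃ < 0) ∨
         (2 * (R₁ + R₂) * t₀ < -(√(R₁ * R₂) * t₃) ∧ t₃ > 0)) :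
    UndergoesSubcriticalHopf R₁ R₂
      (fun t₄ => gaudinMomentumMap R₁ R₂ 0 t₀ t₁ t₂ t₃ t₄)
      pointM0 (t4PlusM0 R₁ R₂ 0 t₁ t₂ t₃) := by
  refine ⟨fun t => isRankZeroSingularity_pointM0 R₁ R₂ 0 t₀ t₁ t₂ t₃ t, ?_⟩
  obtain ⟨s₁, hs₁, h₁⟩ : ∃ s : ℝ, 0 < s ∧ s ^ 2 = R₁ :=
    ⟨√R₁, Real.sqrt_pos.2 hR₁, Real.sq_sqrt hR₁.le⟩
  obtain ⟨s₂, hs₂, h₂⟩ : ∃ s : ℝ, 0 < s ∧ s ^ 2 = R₂ :=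
    ⟨√R₂, Real.sqrt_pos.2 hR₂, Real.sq_sqrt hR₂.le⟩
  have hr : √(R₁ * R₂) = s₁ * s₂ := by
    rw [← h₁, ← h₂, ← mul_pow, Real.sqrt_sq (by positivity)]
  have h2 : √2 ^ 2 = (2 : ℝ) := Real.sq_sqrt (by norm_num)
  have h20 : (0 : ℝ) < √2 := Real.sqrt_pos.2 (by norm_num)
  have hT : t4PlusM0 R₁ R₂ 0 t₁ t₂ t₃ = 2 * t₃ * (s₁ * s₂) / (s₁ ^ 2 + s₂ ^ 2) := by
    rw [t4PlusM0, hr, h₁, h₂]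
    simp
  rw [hr] at h
  rw [hT]
  subst h₁ h₂
  have hq : s₁ ^ 2 - s₂ ^ 2 ≠ 0 := sub_ne_zero.2 hR
  have ht₃ : t₃ ≠ 0 := by
    rcases h with ⟨-, h⟩ | ⟨-, h⟩
    exacts [h.ne, h.ne']
  have hp₁ : (1 / (√2 * s₁)) ^ 2 = 1 / (2 * s₁ ^ 2) := by rw [div_pow, mul_pow, h2, one_pow]
  have hp₂ : (-1 / (√2 * s₂)) ^ 2 = 1 / (2 * s₂ ^ 2) := by
    rw [div_pow, mul_pow, h2, neg_one_sq]
  -- The roots a₁ and a₂ are taken with opposite signs so that κ has the sign of t₃, as the critical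
  -- value t₄⁺ does; equal signs would select the opposite value of t₄.
  have hκ : -2 * (1 / (√2 * s₁)) * (-1 / (√2 * s₂)) * t₃ = t₃ / (s₁ * s₂) := by
    field_simp
    linarith
  -- σ is the sign of t₃, which merges the two cases into one inequality.
  obtain ⟨σ, hσ, hσt₃, hσa⟩ : ∃ σ : ℝ, (σ = 1 ∨ σ = -1) ∧ 0 < σ * t₃ ∧
      σ * (2 * (s₁ ^ 2 + s₂ ^ 2) * t₀ + s₁ * s₂ * t₃) < 0 := by
    rcases h with ⟨h, h'⟩ | ⟨h, h'⟩
    · exact ⟨-1, Or.inr rfl, by linarith, by linarith⟩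
    · exact ⟨1, Or.inl rfl, by linarith, by linarith⟩
  have e₁ : 2 * s₁ ^ 2 * (1 / (√2 * s₁)) ^ 2 = 1 := by rw [hp₁]; field_simp
  have e₂ : 2 * s₂ ^ 2 * (-1 / (√2 * s₂)) ^ 2 = 1 := by rw [hp₂]; field_simp
  have hκ0 : 0 < σ * (-2 * (1 / (√2 * s₁)) * (-1 / (√2 * s₂)) * t₃) := by
    rw [hκ, ← mul_div_assoc]
    positivity
  have hT' : 2 * t₃ * (s₁ * s₂) / (s₁ ^ 2 + s₂ ^ 2) *
      ((1 / (√2 * s₁)) ^ 2 + (-1 / (√2 * s₂)) ^ 2) =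
      -2 * (1 / (√2 * s₁)) * (-1 / (√2 * s₂)) * t₃ := by
    rw [hκ, hp₁, hp₂]
    field_simp
    ring
  have hdiff : (-1 / (√2 * s₂)) ^ 2 - (1 / (√2 * s₁)) ^ 2 ≠ 0 := by
    have : (-1 / (√2 * s₂)) ^ 2 - (1 / (√2 * s₁)) ^ 2 =
        (s₁ ^ 2 - s₂ ^ 2) / (2 * s₁ ^ 2 * s₂ ^ 2) := by
      rw [hp₁, hp₂]
      field_simp
    rw [this]
    positivity
  refine ⟨_, σ, _, ?_, hσ, hasLinearHopfUnfolding_gaudin e₁ e₂ t₀ t₁ t₂ hσ hκ0 hT',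
    hasHopfNormalForm_gaudin e₁ e₂ t₀ t₁ t₂ hσ hκ0 hT', ?_⟩
  · exact mul_ne_zero (by positivity) hdiff
  · have hneg : σ * (t₀ + 2 * t₃ * (s₁ * s₂) / (s₁ ^ 2 + s₂ ^ 2) / 4) < 0 := by
      have : σ * (t₀ + 2 * t₃ * (s₁ * s₂) / (s₁ ^ 2 + s₂ ^ 2) / 4) =
          σ * (2 * (s₁ ^ 2 + s₂ ^ 2) * t₀ + s₁ * s₂ * t₃) / (2 * (s₁ ^ 2 + s₂ ^ 2)) := by
        field_simp
        ring
      rw [this]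
      exact div_neg_of_neg_of_pos hσa (by positivity)
    rw [mul_left_comm, mul_left_comm σ (_ ^ 2)]
    exact mul_neg_of_pos_of_neg (pow_pos (by linarith) 2)
      (mul_neg_of_pos_of_neg (by positivity) hneg)
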